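/- Let $r\ge 1$. An $r$-graph is a finite family $H$ of $r$-element subsets (edges) of $\mathbb{N}$. Its Lagrangian is $$\lambda(H)=\max\Big\{\sum_{A\in H}\prod_{i\in A}y_i \;:\; y_i\ge 0 \text{ for all } i\in\mathbb{N},\ y_i=0 \text{ for all but finitely many } i,\ \sum_{i\in\mathbb{N}} y_i=1\Big\}.$$ Let $H^{m,r}$ be the $r$-graph formed by the first $m$ of the $r$-element subsets of $\mathbb{N}$ in the colexicographic order, in which $A<B$ if $A\ne B$ and $\max(A\triangle B)\in B$. Theorem. For every integer $r\ge 4$ there is a constant $\gamma_r>0$ such that for all integers $t\ge 1$ and $m\ge 0$ with $$\binom{t-1}{r}\le m\le\binom{t}{r}-\gamma_r t^{r-2}$$ we have $$\lambda(H^{m,r})=\max\{\lambda(H) : H \text{ is an } r\text{-graph with exactly } m \text{ edges}\}.$$ -/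

import Mathlib

open Finset

namespace FranklFuredi

/-- A finite `r`-uniform hypergraph (an `r`-graph) on the vertex set `ℕ`, given by its finite set
of edges: every edge has exactly `r` vertices. -/
def IsRGraph (r : ℕ) (H : Finset (Finset ℕ)) : Prop :=
  ∀ A ∈ H, #A = r

/-- The polynomial `L(H, y) = ∑_{A ∈ H} ∏_{i ∈ A} y_i`. -/
noncomputable def lagrangePoly (H : Finset (Finset ℕ)) (y : ℕ →₀ ℝ) : ℝ :=
  ∑ A ∈ H, ∏ i ∈ A, y i

/-- The standard simplex of weightings: finitely supported `y` with `y_i ≥ 0` and `∑ y_i = 1`. -/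
def simplex : Set (ℕ →₀ ℝ) :=
  {y | (∀ i, 0 ≤ y i) ∧ ∑ i ∈ y.support, y i = 1}

/-- The Lagrangian `λ(H)`: the maximum of `L(H, y)` over the standard simplex. The supremum
is attained, see `isGreatest_lagrangian`. -/
noncomputable def lagrangian (H : Finset (Finset ℕ)) : ℝ :=
  sSup (lagrangePoly H '' simplex)

/-- `H^{m,r}` (for `r ≥ 1`): the first `m` of the `r`-element subsets of `ℕ` in the colexicographic order, that
is, those having fewer than `m` colex-predecessors of size `r`. For `r ≥ 1` these sets, as well as
all their predecessors, are contained in `{0, …, m + r - 1}`. -/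
def colexInit (m r : ℕ) : Finset (Finset ℕ) :=
  {A ∈ (range (m + r)).powersetCard r |
    #{B ∈ (range (m + r)).powersetCard r | toColex B < toColex A} < m}

/-- The colexicographic order: `B < A` iff `B ≠ A` and the maximum of the symmetric difference
belongs to `A`. -/
theorem colex_lt_iff (A B : Finset ℕ) :
    toColex B < toColex A ↔ ∃ h : B ≠ A, (symmDiff B A).max' (symmDiff_nonempty.2 h) ∈ A :=
  Finset.Colex.toColex_lt_toColex_iff_max'_mem

theorem colexInit_isInitSeg (m r : ℕ) : Colex.IsInitSeg (colexInit m r) r := by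
  refine ⟨fun A hA => ?_, ?_⟩
  · have hA' : A ∈ colexInit m r := hA
    simp only [colexInit, mem_filter, mem_powersetCard] at hA'
    exact hA'.1.2
  · rintro A B hA ⟨hBA, hB⟩
    simp only [colexInit, mem_filter, mem_powersetCard] at hA ⊢
    refine ⟨⟨fun b hb => ?_, hB⟩, lt_of_le_of_lt (card_le_card ?_) hA.2⟩
    · exact mem_range.2 (Colex.forall_lt_mono hBA.le (fun c hc => mem_range.1 (hA.1.1 hc)) b hb)
    · intro C hC
      simp only [mem_filter] at hC ⊢
      exact ⟨hC.1, hC.2.trans hBA⟩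

theorem card_colexInit (m r : ℕ) (hr : 1 ≤ r) : #(colexInit m r) = m := by
  classical
  set S := (range (m + r)).powersetCard r with hS
  set f : Finset ℕ → ℕ := fun A => #{B ∈ S | toColex B < toColex A} with hf
  have hmono : ∀ A ∈ S, ∀ B, toColex A < toColex B → f A < f B := by
    intro A hA B hAB
    refine card_lt_card ⟨fun C hC => ?_, fun h => ?_⟩
    · simp only [mem_filter] at hC ⊢
      exact ⟨hC.1, hC.2.trans hAB⟩
    · have := h (mem_filter.2 ⟨hA, hAB⟩)
      simp at this
  have hinj : Set.InjOn f S := by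
    intro A hA B hB hAB
    rcases lt_trichotomy (toColex A) (toColex B) with h | h | h
    · exact absurd hAB (hmono A hA B h).ne
    · simpa using h
    · exact absurd hAB (hmono B hB A h).ne'
  have himg : S.image f = range #S := by
    refine eq_of_subset_of_card_le ?_ ?_
    · intro k hk
      obtain ⟨A, hA, rfl⟩ := mem_image.1 hk
      refine mem_range.2 (card_lt_card ⟨filter_subset _ _, fun h => ?_⟩)
      have := h hA
      simp at this
    · rw [card_image_of_injOn hinj, card_range]
  have hcard : m ≤ #S := by
    rw [hS, card_powersetCard, card_range]
    obtain ⟨k, rfl⟩ : ∃ k, r = k + 1 := ⟨r - 1, by omega⟩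
    rcases Nat.eq_zero_or_pos m with rfl | hm
    · simp
    · clear hm hS hf hmono hinj himg
      induction m with
      | zero => simp
      | succ n ih =>
        have h2 : (n + 1 + (k + 1)).choose (k + 1)
            = (n + (k + 1)).choose k + (n + (k + 1)).choose (k + 1) := by
          rw [show n + 1 + (k + 1) = (n + (k + 1)) + 1 by omega, Nat.choose_succ_succ]
        have h3 : 0 < (n + (k + 1)).choose k := Nat.choose_pos (by omega)
        omega
  have h1 : (colexInit m r).image f = range m := by
    ext k
    simp only [mem_image, mem_range]
    constructor
    · rintro ⟨A, hA, rfl⟩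
      exact (mem_filter.1 hA).2
    · intro hk
      have : k ∈ S.image f := by rw [himg]; exact mem_range.2 (by omega)
      obtain ⟨A, hA, rfl⟩ := mem_image.1 this
      exact ⟨A, mem_filter.2 ⟨hA, hk⟩, rfl⟩
  have h2 : Set.InjOn f (colexInit m r) :=
    hinj.mono (fun A hA => (mem_filter.1 hA).1)
  rw [← card_image_of_injOn h2, h1, card_range]

/-- The maximum defining the Lagrangian exists. -/
theorem isGreatest_lagrangian (H : Finset (Finset ℕ)) :
    IsGreatest (lagrangePoly H '' simplex) (lagrangian H) := by
  classical
  suffices h : ∃ a, IsGreatest (lagrangePoly H '' simplex) a by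
    obtain ⟨a, ha⟩ := h
    have : lagrangian H = a := ha.csSup_eq
    rwa [this]
  set V : Finset ℕ := insert 0 (H.biUnion id) with hV
  have hVH : ∀ A ∈ H, ∀ i ∈ A, i ∈ V := fun A hA i hi =>
    mem_insert_of_mem (mem_biUnion.2 ⟨A, hA, hi⟩)
  have h0 : 0 ∈ V := mem_insert_self _ _
  -- extension by zero
  let E : (V → ℝ) → (ℕ →₀ ℝ) := fun x =>
    Finsupp.onFinset V (fun i => if h : i ∈ V then x ⟨i, h⟩ else 0) (by
      intro i hi
      by_contra h
      simp [h] at hi)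
  have hE : ∀ x i, E x i = if h : i ∈ V then x ⟨i, h⟩ else 0 := fun x i => rfl
  have hEsum : ∀ x, ∑ i ∈ (E x).support, E x i = ∑ v, x v := by
    intro x
    rw [sum_subset (Finsupp.support_onFinset_subset : (E x).support ⊆ V)
      (fun i _ hi => Finsupp.notMem_support_iff.1 hi), ← sum_coe_sort V]
    refine sum_congr rfl fun v _ => ?_
    simp [hE]
  have hcont : Continuous fun x : V → ℝ => lagrangePoly H (E x) := by
    unfold lagrangePoly
    refine continuous_finsetSum _ fun A hA => continuous_finsetProd _ fun i hi => ?_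
    have : i ∈ V := hVH A hA i hi
    simp only [hE, this, dif_pos]
    exact continuous_apply _
  have hne : (stdSimplex ℝ V).Nonempty :=
    ⟨Pi.single ⟨0, h0⟩ 1, single_mem_stdSimplex ℝ _⟩
  obtain ⟨x, hx, hmax⟩ := (isCompact_stdSimplex ℝ V).exists_isMaxOn hne hcont.continuousOn
  refine ⟨lagrangePoly H (E x), ⟨E x, ⟨fun i => ?_, ?_⟩, rfl⟩, ?_⟩
  · rw [hE]
    split_ifs
    · exact hx.1 _
    · exact le_rfl
  · rw [hEsum]
    exact hx.2
  · rintro _ ⟨y, ⟨hy0, hy1⟩, rfl⟩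
    -- move the weight outside `V` to the vertex `0`
    let c : ℝ := ∑ i ∈ y.support \ V, y i
    have hc : 0 ≤ c := sum_nonneg fun i _ => hy0 i
    let z : V → ℝ := fun v => y v + if (v : ℕ) = 0 then c else 0
    have hyV : ∑ v : V, y v = ∑ i ∈ y.support ∩ V, y i := by
      rw [sum_coe_sort V (fun i => y i)]
      symm
      refine sum_subset inter_subset_right fun i hi hni => ?_
      by_contra h
      exact hni (mem_inter.2 ⟨Finsupp.mem_support_iff.2 h, hi⟩)
    have hcV : ∑ v : V, (if (v : ℕ) = 0 then c else 0) = c := by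
      rw [sum_coe_sort V (fun i => if i = 0 then c else 0), sum_ite_eq' V 0, if_pos h0]
    have hz : z ∈ stdSimplex ℝ V := by
      refine ⟨fun v => add_nonneg (hy0 _) (by split_ifs <;> simp [hc]), ?_⟩
      rw [sum_add_distrib, hyV, hcV, ← hy1]
      exact sum_inter_add_sum_sdiff _ _ _
    refine le_trans ?_ (hmax hz)
    refine sum_le_sum fun A hA => prod_le_prod (fun i _ => hy0 i) fun i hi => ?_
    rw [hE, dif_pos (hVH A hA i hi)]
    simp only [z]
    split_ifs <;> simp [hc]

end FranklFuredi

/-! Take an optimal weighting `x` of a competitor `H`, with support `V` and `σ = ∑ x_i²`. If `V` has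
at most `t - 1` vertices, the clique on `t - 1` vertices, contained in `colexInit m r`, already does
as well. Otherwise suppose `H` beats `colexInit m r`, hence that clique; then `r! λ ≥ 1 -
r(r-1)/(2t) - O(t⁻²)`, and it suffices to find `choose t r - O(t^(r-2))` edges in `H`, contradicting
the bound on `m` (`exists_choose_sub_le_card`).

All weights are `O(1/t)`, so `r! e_r(x) = 1 - r(r-1)σ/2 + O(t⁻²)`. As `λ ≤ e_r(x)`, this gives `σ ≤
1/t + O(t⁻²)`. For the reverse bound put `u_i = t x_i`. For an edge with product `p = ∏ u_i`, AM-GM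
on the numbers `1` and `p u_i` gives `1 + p ∑ u_i ≥ (r+1) p`. Summed over the edges, the Lagrange
multiplier equations turn this into `#H ≥ t^r λ (r + 1 - r t σ)`. Unless `H` already has more than
`t^r / r!` edges, this forces `σ ≥ 1/t - O(t⁻²)`, and the non-edges have total weight `e_r(x) - λ =
O(t⁻²)`.

Non-edges avoiding low vertices (`t x_k ≤ 1/2`) therefore number `O(t^(r-2))`. Stability in AM-GM
leaves only boundedly many low vertices. Non-edges with one low vertex are counted by the multiplier
equation there, and sets with two low vertices are few inside any `t` vertices. -/

namespace FranklFuredi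

/-! ### Elementary symmetric polynomials on the simplex. -/

section Esym

variable {ι κ : Type*}

/-- The elementary symmetric polynomial of degree `k` in the variables `x i`, `i ∈ V`. -/
noncomputable def esym (x : ι → ℝ) (k : ℕ) (V : Finset ι) : ℝ :=
  ∑ A ∈ V.powersetCard k, ∏ i ∈ A, x i

@[simp] theorem esym_zero (x : ι → ℝ) (V : Finset ι) : esym x 0 V = 1 := by
  simp [esym]

theorem esym_one (x : ι → ℝ) (V : Finset ι) : esym x 1 V = ∑ i ∈ V, x i := by
  simp [esym, powersetCard_one]

theorem esym_map (f : κ ↪ ι) (x : ι → ℝ) (k : ℕ) (V : Finset κ) :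
    esym x k (V.map f) = ∑ A ∈ V.powersetCard k, ∏ i ∈ A, x (f i) := by
  simp [esym, powersetCard_map, mapEmbedding_apply]

theorem esym_nonneg {x : ι → ℝ} {V : Finset ι} (hx : ∀ i ∈ V, 0 ≤ x i) (k : ℕ) :
    0 ≤ esym x k V :=
  sum_nonneg fun _ hA => prod_nonneg fun i hi => hx i ((mem_powersetCard.1 hA).1 hi)

theorem esym_mono {x : ι → ℝ} {V W : Finset ι} (hx : ∀ i ∈ W, 0 ≤ x i) (h : V ⊆ W) (k : ℕ) :
    esym x k V ≤ esym x k W :=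
  sum_le_sum_of_subset_of_nonneg (powersetCard_mono h) fun _ hA _ =>
    prod_nonneg fun i hi => hx i ((mem_powersetCard.1 hA).1 hi)

variable [DecidableEq ι]

/-- Double counting of incidences between vertices and edges. -/
theorem sum_sum_mem_comm {V : Finset ι} {H : Finset (Finset ι)} (hH : ∀ A ∈ H, A ⊆ V)
    (f : Finset ι → ι → ℝ) :
    ∑ A ∈ H, ∑ i ∈ A, f A i = ∑ i ∈ V, ∑ A ∈ H with i ∈ A, f A i := by
  refine sum_comm' fun A i => ?_
  simp only [mem_filter]
  exact ⟨fun h => ⟨h, hH A h.1 h.2⟩, fun h => h.1⟩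

theorem sum_powersetCard_mem {V : Finset ι} {i : ι} (hi : i ∈ V) (k : ℕ) (f : Finset ι → ℝ) :
    ∑ A ∈ V.powersetCard (k + 1) with i ∈ A, f (A.erase i) =
      ∑ B ∈ (V.erase i).powersetCard k, f B := by
  refine sum_nbij' (fun A => A.erase i) (fun B => insert i B) ?_ ?_ ?_ ?_ ?_
  · intro A hA
    simp only [mem_filter, mem_powersetCard] at hA ⊢
    exact ⟨erase_subset_erase _ hA.1.1, by rw [card_erase_of_mem hA.2, hA.1.2]; rfl⟩
  · intro B hB
    simp only [mem_filter, mem_powersetCard] at hB ⊢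
    have hiB : i ∉ B := fun h => by simpa using hB.1 h
    refine ⟨⟨insert_subset hi (hB.1.trans (erase_subset _ _)), ?_⟩, mem_insert_self _ _⟩
    rw [card_insert_of_notMem hiB, hB.2]
  · intro A hA
    exact insert_erase (mem_filter.1 hA).2
  · intro B hB
    have hiB : i ∉ B := fun h => by simpa using (mem_powersetCard.1 hB).1 h
    exact erase_insert hiB
  · intro A _
    rfl

theorem succ_mul_esym (x : ι → ℝ) (k : ℕ) (V : Finset ι) :
    (k + 1 : ℝ) * esym x (k + 1) V = ∑ i ∈ V, x i * esym x k (V.erase i) := by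
  have h1 : (k + 1 : ℝ) * esym x (k + 1) V =
      ∑ A ∈ V.powersetCard (k + 1), ∑ i ∈ A, x i * ∏ j ∈ A.erase i, x j := by
    rw [esym, mul_sum]
    refine sum_congr rfl fun A hA => ?_
    rw [sum_congr rfl fun i hi => mul_prod_erase A x hi, sum_const, (mem_powersetCard.1 hA).2]
    simp
  rw [h1, sum_sum_mem_comm (V := V) fun A hA => (mem_powersetCard.1 hA).1]
  refine sum_congr rfl fun i hi => ?_
  rw [← mul_sum, sum_powersetCard_mem hi k fun B => ∏ j ∈ B, x j, esym]

theorem esym_succ_eq_erase (x : ι → ℝ) (k : ℕ) {V : Finset ι} {i : ι} (hi : i ∈ V) :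
    esym x (k + 1) V = esym x (k + 1) (V.erase i) + x i * esym x k (V.erase i) := by
  have h1 : ∑ A ∈ V.powersetCard (k + 1) with i ∈ A, ∏ j ∈ A, x j
      = x i * esym x k (V.erase i) := by
    rw [esym, ← sum_powersetCard_mem hi k fun B => ∏ j ∈ B, x j, mul_sum]
    exact sum_congr rfl fun A hA => (mul_prod_erase A x (mem_filter.1 hA).2).symm
  have h2 : ∑ A ∈ V.powersetCard (k + 1) with i ∉ A, ∏ j ∈ A, x j
      = esym x (k + 1) (V.erase i) := by
    rw [esym]
    congr 1
    ext A
    simp only [mem_filter, mem_powersetCard, subset_erase]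
    tauto
  rw [← h1, ← h2, esym, ← sum_filter_add_sum_filter_not _ (fun A => i ∈ A), add_comm]

theorem factorial_mul_esym_le {x : ι → ℝ} (k : ℕ) {V : Finset ι} (hx : ∀ i ∈ V, 0 ≤ x i) :
    (k.factorial : ℝ) * esym x k V ≤ (∑ i ∈ V, x i) ^ k := by
  induction k with
  | zero => simp
  | succ k ih =>
    have : ((k + 1).factorial : ℝ) * esym x (k + 1) V =
        k.factorial * ∑ i ∈ V, x i * esym x k (V.erase i) := by
      rw [← succ_mul_esym, Nat.factorial_succ]
      push_cast
      ring
    rw [this, pow_succ', sum_mul, mul_sum]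
    refine sum_le_sum fun i hi => ?_
    have h1 : esym x k (V.erase i) ≤ esym x k V := esym_mono hx (erase_subset _ _) k
    calc (k.factorial : ℝ) * (x i * esym x k (V.erase i))
        ≤ k.factorial * (x i * esym x k V) := by gcongr; exact hx i hi
      _ = x i * (k.factorial * esym x k V) := by ring
      _ ≤ _ := mul_le_mul_of_nonneg_left ih (hx i hi)

/-- Splitting `e_{k+1}(V)` by whether `i` is used brings in the squares `x_i²`; this recursion is
the induction step of both Bonferroni bounds. -/
theorem succ_succ_mul_esym {x : ι → ℝ} {V : Finset ι} (hs : ∑ i ∈ V, x i = 1) (k : ℕ) :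
    (k + 2 : ℝ) * esym x (k + 2) V =
      esym x (k + 1) V - ∑ i ∈ V, x i ^ 2 * esym x k (V.erase i) := by
  have h := succ_mul_esym x (k + 1) V
  push_cast at h
  rw [show (k + 2 : ℝ) = k + 1 + 1 by ring, h, ← one_mul (esym x (k + 1) V), ← hs, sum_mul,
    ← sum_sub_distrib]
  refine sum_congr rfl fun i hi => ?_
  rw [esym_succ_eq_erase x k hi]
  ring

/-- Lower Bonferroni-type bound for elementary symmetric polynomials on the simplex. -/
theorem le_factorial_mul_esym {x : ι → ℝ} {V : Finset ι} (hx : ∀ i ∈ V, 0 ≤ x i)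
    (hs : ∑ i ∈ V, x i = 1) (k : ℕ) :
    1 - (k : ℝ) * (k - 1) / 2 * ∑ i ∈ V, x i ^ 2 ≤ k.factorial * esym x k V := by
  induction k with
  | zero => simp
  | succ k ih =>
    rcases k with _ | k
    · simp [esym_one, hs]
    set σ := ∑ i ∈ V, x i ^ 2
    have h1 := succ_succ_mul_esym hs k
    have h2 : ∑ i ∈ V, x i ^ 2 * esym x k (V.erase i) ≤ σ * esym x k V := by
      rw [sum_mul]
      exact sum_le_sum fun i _ =>
        mul_le_mul_of_nonneg_left (esym_mono hx (erase_subset _ _) k) (sq_nonneg _)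
    have h3 : (k.factorial : ℝ) * esym x k V ≤ 1 := by
      simpa [hs] using factorial_mul_esym_le k hx
    have hσ : 0 ≤ σ := sum_nonneg fun i _ => sq_nonneg _
    have h4 : ((k + 1 + 1).factorial : ℝ) * esym x (k + 1 + 1) V =
        (k + 1).factorial * ((k + 2 : ℝ) * esym x (k + 2) V) := by
      rw [Nat.factorial_succ (k + 1)]
      push_cast
      ring
    have h5 : ((k + 1).factorial : ℝ) * ∑ i ∈ V, x i ^ 2 * esym x k (V.erase i)
        ≤ (k + 1) * σ := by
      calc ((k + 1).factorial : ℝ) * ∑ i ∈ V, x i ^ 2 * esym x k (V.erase i)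
          ≤ (k + 1).factorial * (σ * esym x k V) := by gcongr
        _ = (k + 1) * σ * (k.factorial * esym x k V) := by
          rw [Nat.factorial_succ]; push_cast; ring
        _ ≤ (k + 1) * σ * 1 := by gcongr
        _ = _ := mul_one _
    rw [h4, h1, mul_sub]
    push_cast at ih ⊢
    linarith

/-- Upper Bonferroni-type bound for elementary symmetric polynomials on the simplex, when all
variables are small. -/
theorem factorial_mul_esym_le_of_le {x : ι → ℝ} {V : Finset ι} (hx : ∀ i ∈ V, 0 ≤ x i)
    (hs : ∑ i ∈ V, x i = 1) {η : ℝ} (hη : ∀ i ∈ V, x i ≤ η) (hη0 : 0 ≤ η) (k : ℕ) :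
    k.factorial * esym x k V ≤
      1 - (k : ℝ) * (k - 1) / 2 * ∑ i ∈ V, x i ^ 2 + (k : ℝ) ^ 4 * η ^ 2 := by
  set σ := ∑ i ∈ V, x i ^ 2
  have hσ0 : 0 ≤ σ := sum_nonneg fun i _ => sq_nonneg _
  have hση : σ ≤ η := by
    calc σ ≤ ∑ i ∈ V, η * x i := sum_le_sum fun i hi => by
          rw [sq]; exact mul_le_mul_of_nonneg_right (hη i hi) (hx i hi)
      _ = η := by rw [← mul_sum, hs, mul_one]
  -- Deleting one vertex costs only `O(η)`, so the subtracted sum in the recursion is `σ / k!` up to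
  -- `O(η²)`.
  have erase_lb : ∀ k : ℕ, ∀ i ∈ V,
      1 - (k : ℝ) ^ 2 * η ≤ k.factorial * esym x k (V.erase i) := by
    intro k i hi
    rcases k with _ | k
    · simp
    have h1 := esym_succ_eq_erase x k hi
    have h2 : (k.factorial : ℝ) * esym x k (V.erase i) ≤ 1 := by
      refine (mul_le_mul_of_nonneg_left (esym_mono hx (erase_subset i V) k) (by positivity)).trans ?_
      simpa [hs] using factorial_mul_esym_le k hx
    have h3 := le_factorial_mul_esym hx hs (k + 1)
    rw [h1, mul_add] at h3
    have h4 : ((k + 1).factorial : ℝ) * (x i * esym x k (V.erase i)) ≤ (k + 1) * η := by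
      calc ((k + 1).factorial : ℝ) * (x i * esym x k (V.erase i))
          = (k + 1) * (x i * (k.factorial * esym x k (V.erase i))) := by
            rw [Nat.factorial_succ]; push_cast; ring
        _ ≤ (k + 1) * (η * 1) := by
            have h := hx i hi
            have h' := hη i hi
            have h0 : 0 ≤ (k.factorial : ℝ) * esym x k (V.erase i) := mul_nonneg (by positivity)
              (esym_nonneg (fun j hj => hx j (erase_subset _ _ hj)) k)
            gcongr
        _ = _ := by ring
    push_cast at h3 ⊢
    have h5 : ((k : ℝ) + 1) * (k + 1 - 1) / 2 * σ ≤ ((k : ℝ) + 1) * (k + 1 - 1) / 2 * η := by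
      gcongr
      simp only [add_sub_cancel_right]
      positivity
    have hk : (0 : ℝ) ≤ k := Nat.cast_nonneg k
    nlinarith [mul_nonneg hk hη0, mul_nonneg (mul_nonneg hk hk) hη0]
  induction k with
  | zero => simp
  | succ k ih =>
    rcases k with _ | k
    · simp [esym_one, hs, hη0]
    have h1 := succ_succ_mul_esym hs k
    have h4 : ((k + 1 + 1).factorial : ℝ) * esym x (k + 1 + 1) V =
        (k + 1).factorial * ((k + 2 : ℝ) * esym x (k + 2) V) := by
      rw [Nat.factorial_succ (k + 1)]
      push_cast
      ring
    have h5 : (k + 1) * (σ * (1 - (k : ℝ) ^ 2 * η)) ≤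
        ((k + 1).factorial : ℝ) * ∑ i ∈ V, x i ^ 2 * esym x k (V.erase i) := by
      calc (k + 1) * (σ * (1 - (k : ℝ) ^ 2 * η))
          ≤ (k + 1) * ∑ i ∈ V, x i ^ 2 * (k.factorial * esym x k (V.erase i)) := by
            rw [sum_mul]
            gcongr with i hi
            exact erase_lb k i hi
        _ = _ := by
            rw [Nat.factorial_succ, mul_sum, mul_sum]
            push_cast
            exact sum_congr rfl fun i _ => by ring
    rw [h4, h1, mul_sub]
    push_cast at ih ⊢
    have hk : (0 : ℝ) ≤ k := Nat.cast_nonneg k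
    have h6 : (k + 1) * (k : ℝ) ^ 2 * (σ * η) ≤ (k + 1) * (k : ℝ) ^ 2 * (η * η) := by gcongr
    -- The error constant `k ^ 4` grows fast enough to absorb the new error `(k + 1) k² η²`.
    have h7 : 0 ≤ ((k : ℝ) + 2) ^ 4 - (k + 1) ^ 4 - (k + 1) * k ^ 2 := by
      ring_nf
      positivity
    nlinarith [mul_nonneg h7 (sq_nonneg η)]

end Esym

end FranklFuredi

namespace FranklFuredi

/-! ### AM-GM for a single edge, with stability. -/

section AmGm

variable {ι : Type*}

theorem card_mul_le_sum_of_prod_eq_pow {s : Finset ι} {b : ι → ℝ} (hb : ∀ i ∈ s, 0 ≤ b i)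
    {g : ℝ} (hg : 0 ≤ g) (h : ∏ i ∈ s, b i = g ^ #s) : #s * g ≤ ∑ i ∈ s, b i := by
  rcases s.eq_empty_or_nonempty with rfl | hs
  · simp
  have hc : (0 : ℝ) < #s := by exact_mod_cast hs.card_pos
  have h1 := Real.geom_mean_le_arith_mean s (fun _ => 1) b (by simp) (by simpa using hs) hb
  simp only [Real.rpow_one, h, sum_const, nsmul_eq_mul, mul_one, one_mul] at h1
  rwa [Real.pow_rpow_inv_natCast hg hs.card_pos.ne', le_div_iff₀ hc, mul_comm] at h1

variable [DecidableEq ι]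

/-- AM-GM for the `#e + 1` numbers `1` and `p u_i`, the `k`-th rescaled by `s ^ (#e + 1)`: their
product is `(s p) ^ (#e + 1)`. The case `s = 1` is the plain inequality; `s > 1` exploits a small `u
k`. -/
theorem mul_prod_le_of_weighted {e : Finset ι} {u : ι → ℝ} (hu : ∀ i ∈ e, 0 ≤ u i) {k : ι}
    (hk : k ∈ e) {s : ℝ} (hs : 0 ≤ s) :
    (#e + 1 : ℝ) * (s * ∏ i ∈ e, u i) ≤
      1 + (∏ i ∈ e, u i) * (∑ i ∈ e, u i + (s ^ (#e + 1) - 1) * u k) := by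
  set p := ∏ i ∈ e, u i with hp
  have hp0 : 0 ≤ p := prod_nonneg hu
  have hs0 : 0 ≤ s ^ (#e + 1) := pow_nonneg hs _
  have h := card_mul_le_sum_of_prod_eq_pow (s := insertNone e)
    (b := fun o => o.elim 1 fun i => p * (u i * if i = k then s ^ (#e + 1) else 1))
    (g := s * p) ?_ (mul_nonneg hs hp0) ?_
  · rw [card_insertNone, sum_insertNone] at h
    simp only [Option.elim] at h
    rw [← mul_sum] at h
    have h2 : ∑ i ∈ e, (u i * if i = k then s ^ (#e + 1) else 1)
        = ∑ i ∈ e, u i + (s ^ (#e + 1) - 1) * u k := by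
      rw [← sum_erase_add _ _ hk, ← sum_erase_add e u hk, if_pos rfl,
        sum_congr rfl fun i hi => by rw [if_neg (ne_of_mem_erase hi), mul_one]]
      ring
    rw [h2] at h
    exact_mod_cast h
  · rintro (_ | i) hi
    · simp
    · have := hu i (by simpa using hi)
      simp only [Option.elim]
      split_ifs <;> positivity
  · rw [card_insertNone, prod_insertNone]
    simp only [Option.elim, prod_mul_distrib, prod_const, one_mul, prod_ite_eq', if_pos hk, ← hp]
    rw [mul_pow, pow_succ p]
    ring

theorem card_add_one_mul_prod_le {e : Finset ι} {u : ι → ℝ} (hu : ∀ i ∈ e, 0 ≤ u i) :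
    (#e + 1 : ℝ) * ∏ i ∈ e, u i ≤ 1 + (∏ i ∈ e, u i) * ∑ i ∈ e, u i := by
  rcases e.eq_empty_or_nonempty with rfl | ⟨k, hk⟩
  · simp
  · simpa using mul_prod_le_of_weighted hu hk zero_le_one

/-- A stability version of `card_add_one_mul_prod_le`: if one variable is far below `1`, the
inequality has a definite slack. -/
theorem card_add_one_mul_prod_add_le {e : Finset ι} {u : ι → ℝ} (hu : ∀ i ∈ e, 0 ≤ u i) {k : ι}
    (hk : k ∈ e) (huk : u k ≤ 1 / 2) :
    (#e + 1 : ℝ) * ∏ i ∈ e, u i + 1 / (24 * (#e + 1)) ≤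
      1 + (∏ i ∈ e, u i) * ∑ i ∈ e, u i := by
  set p := ∏ i ∈ e, u i with hp
  have hp0 : 0 ≤ p := prod_nonneg hu
  set N : ℝ := #e + 1 with hN
  have hN1 : 1 ≤ N := by simp [hN]
  have hsum : 0 ≤ ∑ i ∈ e, u i := sum_nonneg hu
  by_cases hpN : p ≤ 1 / (2 * N)
  · have h1 : N * p ≤ 1 / 2 := by
      calc N * p ≤ N * (1 / (2 * N)) := by gcongr
        _ = 1 / 2 := by field_simp
    have h2 : 1 / (24 * N) ≤ 1 / 2 := by
      apply one_div_le_one_div_of_le <;> linarith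
    nlinarith [mul_nonneg hp0 hsum]
  · push Not at hpN
    -- With `s = 1 + δ` the left side gains `N δ p = p / 4`, while the rescaled term costs at most
    -- `(4/3 - 1) (1/2) p = p / 6`. The remaining `p / 12` exceeds `1 / (24 N)` because `p > 1 / (2
    -- N)`.
    set δ : ℝ := 1 / (4 * N) with hδ
    have hδ0 : 0 < δ := by positivity
    have hNδ : N * δ = 1 / 4 := by rw [hδ]; field_simp
    have hδ1 : δ ≤ 1 / 4 := by
      rw [← hNδ]; nlinarith
    have h := mul_prod_le_of_weighted hu hk (s := 1 + δ) (by positivity)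
    rw [← hp, ← hN] at h
    -- Bernoulli gives `(1 - δ) ^ (#e + 1) ≥ 3/4`, and `(1 + δ)(1 - δ) ≤ 1`.
    have hτ : (1 + δ) ^ (#e + 1) ≤ 4 / 3 := by
      have hb := one_add_mul_le_pow (a := -δ) (by linarith) (#e + 1)
      push_cast at hb
      rw [← hN] at hb
      have h3 : (1 + δ) ^ (#e + 1) * (1 + -δ) ^ (#e + 1) ≤ 1 := by
        rw [← mul_pow]
        exact pow_le_one₀ (by nlinarith) (by nlinarith)
      have h4 : 0 < (1 + δ) ^ (#e + 1) := by positivity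
      nlinarith
    have hτ1 : 1 ≤ (1 + δ) ^ (#e + 1) := one_le_pow₀ (by linarith)
    have h5 : ((1 + δ) ^ (#e + 1) - 1) * u k ≤ 1 / 6 := by
      nlinarith [hu k hk]
    have h6 : 1 / (24 * N) ≤ p / 12 := by
      have : 1 / (24 * N) = 1 / (2 * N) / 12 := by field_simp; norm_num
      rw [this]
      linarith
    have h7 : N * ((1 + δ) * p) = N * p + p / 4 := by
      linear_combination p * hNδ
    have h8 : p * (∑ i ∈ e, u i + ((1 + δ) ^ (#e + 1) - 1) * u k)
        ≤ p * ∑ i ∈ e, u i + p * (1 / 6) := by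
      rw [mul_add]; gcongr
    linarith

end AmGm

end FranklFuredi

namespace FranklFuredi

/-! ### Stationary weightings: estimates for `σ`, the slack and the degrees. -/

theorem factorial_mul_eq_pred {r : ℕ} (hr : 1 ≤ r) (a : ℝ) :
    (r.factorial : ℝ) * a = (r - 1).factorial * (r * a) := by
  rw [← Nat.mul_factorial_pred (by omega : r ≠ 0)]
  push_cast
  ring

theorem one_sub_div_le_of_le {r t L : ℝ} (ht : 1 ≤ t) (hr : 0 ≤ r)
    (hL : 1 - r * (r - 1) / 2 / t - r ^ 2 / t ^ 2 ≤ L) : 1 - 2 * r ^ 2 / t ≤ L := by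
  refine le_trans ?_ hL
  have h1 : r * (r - 1) / 2 / t ≤ r ^ 2 / t := by
    gcongr
    nlinarith
  have h2 : r ^ 2 / t ^ 2 ≤ r ^ 2 / t := by
    gcongr
    nlinarith
  have h3 : 2 * r ^ 2 / t = r ^ 2 / t + r ^ 2 / t := by ring
  linarith

/-- The weighting `x` of the vertex set `V` has total weight `1`, gives the `r`-graph `H` the weight
`lam`, and satisfies the Lagrange multiplier equations at all vertices of `V`. -/
structure IsStationary {ι : Type*} [DecidableEq ι] (r : ℕ) (V : Finset ι) (x : ι → ℝ)
    (H : Finset (Finset ι)) (lam : ℝ) : Prop where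
  nonneg : ∀ i ∈ V, 0 ≤ x i
  sum_eq : ∑ i ∈ V, x i = 1
  subset : H ⊆ V.powersetCard r
  sum_prod : ∑ A ∈ H, ∏ i ∈ A, x i = lam
  deriv : ∀ k ∈ V, ∑ A ∈ H with k ∈ A, ∏ i ∈ A.erase k, x i = r * lam

namespace IsStationary

variable {ι : Type*} [DecidableEq ι] {r : ℕ} {V : Finset ι} {x : ι → ℝ}
  {H : Finset (Finset ι)} {lam : ℝ} (h : IsStationary r V x H lam)
include h

theorem nonneg_of_mem {A : Finset ι} (hA : A ∈ V.powersetCard r) {i : ι} (hi : i ∈ A) : 0 ≤ x i :=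
  h.nonneg i ((mem_powersetCard.1 hA).1 hi)

theorem prod_nonneg {A : Finset ι} (hA : A ∈ V.powersetCard r) : 0 ≤ ∏ i ∈ A, x i :=
  Finset.prod_nonneg fun _ hi => h.nonneg_of_mem hA hi

theorem lam_nonneg : 0 ≤ lam := by
  rw [← h.sum_prod]
  exact sum_nonneg fun A hA => h.prod_nonneg (h.subset hA)

theorem lam_le_esym : lam ≤ esym x r V := by
  rw [← h.sum_prod]
  exact sum_le_sum_of_subset_of_nonneg h.subset fun A hA _ => h.prod_nonneg hA

theorem factorial_mul_lam_le_one : r.factorial * lam ≤ 1 := by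
  refine (mul_le_mul_of_nonneg_left h.lam_le_esym (by positivity)).trans ?_
  simpa [h.sum_eq] using factorial_mul_esym_le r h.nonneg

theorem sum_not_mem_eq {k : ι} (hk : k ∈ V) (hr : 1 ≤ r) :
    ∑ A ∈ V.powersetCard r \ H with k ∈ A, ∏ i ∈ A.erase k, x i =
      esym x (r - 1) (V.erase k) - r * lam := by
  obtain ⟨s, rfl⟩ : ∃ s, r = s + 1 := ⟨r - 1, by omega⟩
  rw [Nat.add_sub_cancel, esym, ← sum_powersetCard_mem hk s fun B => ∏ i ∈ B, x i,
    ← h.deriv k hk, eq_sub_iff_add_eq, sum_filter, sum_filter, sum_filter]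
  exact sum_sdiff h.subset

/-- The link of `k` lives on total weight `1 - x k`, so its weight `r λ` is at most `(1 - x k)^(r-1)
/ (r-1)!`. Hence no vertex is heavy when `r! λ` is near `1`. -/
theorem factorial_mul_lam_le (hr : 2 ≤ r) {k : ι} (hk : k ∈ V) :
    r.factorial * lam ≤ 1 - x k := by
  have h0 : ∀ i ∈ V.erase k, 0 ≤ x i := fun i hi => h.nonneg i (mem_of_mem_erase hi)
  have hsum : ∑ i ∈ V.erase k, x i = 1 - x k := by
    rw [← h.sum_eq, ← sum_erase_add _ _ hk]
    ring
  have h1 : r * lam ≤ esym x (r - 1) (V.erase k) := by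
    rw [← sub_nonneg, ← h.sum_not_mem_eq hk (by omega)]
    refine sum_nonneg fun A hA => Finset.prod_nonneg fun i hi => ?_
    simp only [mem_filter, mem_sdiff] at hA
    exact h.nonneg_of_mem hA.1.1 (mem_of_mem_erase hi)
  have h2 : 0 ≤ 1 - x k := hsum ▸ sum_nonneg h0
  have h3 := h.nonneg k hk
  rw [factorial_mul_eq_pred (by omega)]
  calc ((r - 1).factorial : ℝ) * (r * lam)
      ≤ (r - 1).factorial * esym x (r - 1) (V.erase k) := by gcongr
    _ ≤ (1 - x k) ^ (r - 1) := hsum ▸ factorial_mul_esym_le (r - 1) h0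
    _ ≤ (1 - x k) ^ 1 := pow_le_pow_of_le_one h2 (by linarith) (by omega)
    _ = _ := pow_one _

/-- The total slack in the inequality of arithmetic and geometric means over all edges. -/
theorem sum_slack (t : ℝ) :
    ∑ A ∈ H, (1 + (∏ i ∈ A, t * x i) * ∑ i ∈ A, t * x i - (r + 1) * ∏ i ∈ A, t * x i) =
      #H - t ^ r * lam * (r + 1 - r * (t * ∑ i ∈ V, x i ^ 2)) := by
  have hcard : ∀ A ∈ H, #A = r := fun A hA => (mem_powersetCard.1 (h.subset hA)).2
  -- Exchanging the sums leaves `x_i²` times the partial derivative at `i`, which is `r λ` at every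
  -- vertex.
  have h1 : ∑ A ∈ H, (∏ i ∈ A, x i) * ∑ i ∈ A, x i = r * lam * ∑ i ∈ V, x i ^ 2 := by
    have : ∀ A ∈ H, (∏ i ∈ A, x i) * ∑ i ∈ A, x i = ∑ i ∈ A, x i ^ 2 * ∏ j ∈ A.erase i, x j := by
      intro A _
      rw [mul_sum]
      refine sum_congr rfl fun i hi => ?_
      rw [← mul_prod_erase A x hi]
      ring
    rw [sum_congr rfl this, sum_sum_mem_comm fun A hA => (mem_powersetCard.1 (h.subset hA)).1,
      mul_sum]
    refine sum_congr rfl fun i hi => ?_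
    rw [← mul_sum, h.deriv i hi]
    ring
  have h2 : ∀ A ∈ H,
      1 + (∏ i ∈ A, t * x i) * ∑ i ∈ A, t * x i - (r + 1) * ∏ i ∈ A, t * x i =
      1 + t ^ r * t * ((∏ i ∈ A, x i) * ∑ i ∈ A, x i) - (r + 1) * t ^ r * ∏ i ∈ A, x i := by
    intro A hA
    rw [prod_mul_distrib, prod_const, hcard A hA, ← mul_sum]
    ring
  rw [sum_congr rfl h2, sum_sub_distrib, sum_add_distrib, ← mul_sum, ← mul_sum, h1, h.sum_prod]
  simp only [sum_const, nsmul_eq_mul, mul_one]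
  ring

theorem slack_nonneg {t : ℝ} (ht : 0 ≤ t) {A : Finset ι} (hA : A ∈ H) :
    0 ≤ 1 + (∏ i ∈ A, t * x i) * ∑ i ∈ A, t * x i - (r + 1) * ∏ i ∈ A, t * x i := by
  have hA' := h.subset hA
  have := card_add_one_mul_prod_le (e := A) (u := fun i => t * x i)
    fun i hi => mul_nonneg ht (h.nonneg_of_mem hA' hi)
  rw [(mem_powersetCard.1 hA').2] at this
  linarith

theorem le_slack {t : ℝ} (ht : 0 ≤ t) {A : Finset ι} (hA : A ∈ H) {k : ι} (hk : k ∈ A)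
    (hxk : t * x k ≤ 1 / 2) : 1 / (24 * (r + 1)) ≤
      1 + (∏ i ∈ A, t * x i) * ∑ i ∈ A, t * x i - (r + 1) * ∏ i ∈ A, t * x i := by
  have hA' := h.subset hA
  have := card_add_one_mul_prod_add_le (e := A) (u := fun i => t * x i)
    (fun i hi => mul_nonneg ht (h.nonneg_of_mem hA' hi)) hk hxk
  rw [(mem_powersetCard.1 hA').2] at this
  linarith

section Bounds

variable {t : ℝ} (ht : 1 ≤ t) (hr : 2 ≤ r)
  (hlam : 1 - (r : ℝ) * (r - 1) / 2 / t - r ^ 2 / t ^ 2 ≤ r.factorial * lam)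
include ht hr hlam

theorem le_two_mul_sq_div {k : ι} (hk : k ∈ V) : x k ≤ 2 * r ^ 2 / t := by
  have h1 := one_sub_div_le_of_le ht (Nat.cast_nonneg r) hlam
  have h2 := h.factorial_mul_lam_le hr hk
  linarith

theorem factorial_mul_esym_sub_lam_le :
    r.factorial * (esym x r V - lam) ≤
      (r : ℝ) * (r - 1) / 2 * (1 / t - ∑ i ∈ V, x i ^ 2) + (4 * r ^ 8 + r ^ 2) / t ^ 2 := by
  have h1 := factorial_mul_esym_le_of_le h.nonneg h.sum_eq
    (fun k hk => h.le_two_mul_sq_div ht hr hlam hk) (by positivity) r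
  have h2 : (r : ℝ) ^ 4 * (2 * r ^ 2 / t) ^ 2 = 4 * r ^ 8 / t ^ 2 := by ring
  have h3 : (4 * (r : ℝ) ^ 8 + r ^ 2) / t ^ 2 = 4 * r ^ 8 / t ^ 2 + r ^ 2 / t ^ 2 := by ring
  have h4 : (r : ℝ) * (r - 1) / 2 / t = r * (r - 1) / 2 * (1 / t) := by ring
  rw [h2] at h1
  rw [h4] at hlam
  rw [h3]
  linarith

/-- The non-edges have nonnegative weight, so `1/t - σ` cannot be more negative than the error term.
-/
theorem mul_sum_sq_le : t * ∑ i ∈ V, x i ^ 2 ≤ 1 + (4 * r ^ 8 + r ^ 2) / t := by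
  have h1 := h.factorial_mul_esym_sub_lam_le ht hr hlam
  have h2 : 0 ≤ r.factorial * (esym x r V - lam) :=
    mul_nonneg (by positivity) (sub_nonneg.2 h.lam_le_esym)
  have hr' : (2 : ℝ) ≤ r := by exact_mod_cast hr
  have hb : 1 ≤ (r : ℝ) * (r - 1) / 2 := by nlinarith
  have ht0 : 0 < t := by linarith
  have hA : 0 ≤ (4 * (r : ℝ) ^ 8 + r ^ 2) / t ^ 2 := by positivity
  have h3 : ∑ i ∈ V, x i ^ 2 ≤ 1 / t + (4 * (r : ℝ) ^ 8 + r ^ 2) / t ^ 2 := by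
    by_contra! h3
    nlinarith
  calc t * ∑ i ∈ V, x i ^ 2 ≤ t * (1 / t + (4 * (r : ℝ) ^ 8 + r ^ 2) / t ^ 2) := by gcongr
    _ = _ := by field_simp

/-- Nonnegativity of the total slack, with at most `t^r / r!` edges, gives `r! λ (r + 1 - r t σ) ≤
1`, where `r! λ` is close to `1`. -/
theorem le_mul_sum_sq (ht' : 4 * r ^ 2 ≤ t) (hH : #H ≤ t ^ r / r.factorial) :
    1 - 4 * r ^ 2 / t ≤ t * ∑ i ∈ V, x i ^ 2 := by
  have ht0 : 0 < t := by linarith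
  have h1 := h.sum_slack t
  have h2 := sum_nonneg fun A hA => h.slack_nonneg ht0.le hA
  rw [h1] at h2
  have h3 := one_sub_div_le_of_le ht (Nat.cast_nonneg r) hlam
  set y := t * ∑ i ∈ V, x i ^ 2
  set L := r.factorial * lam
  have hf : (0 : ℝ) < r.factorial := by positivity
  have htr : 0 < t ^ r := by positivity
  have h4 : L * (r + 1 - r * y) ≤ 1 := by
    have h5 : t ^ r * lam * (r + 1 - r * y) ≤ t ^ r / r.factorial := by linarith
    rw [le_div_iff₀ hf] at h5
    refine le_of_mul_le_mul_left (?_ : t ^ r * _ ≤ t ^ r * 1) htr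
    calc _ = t ^ r * lam * (r + 1 - r * y) * r.factorial := by simp only [L]; ring
      _ ≤ _ := by linarith
  set z := 2 * (r : ℝ) ^ 2 / t with hz
  have hz0 : 0 ≤ z := by positivity
  have hz1 : z ≤ 1 / 2 := by
    rw [hz, div_le_iff₀ ht0]; linarith
  have hz2 : 4 * (r : ℝ) ^ 2 / t = 2 * z := by rw [hz]; ring
  rw [hz2]
  by_contra! hy
  have hr' : (2 : ℝ) ≤ r := by exact_mod_cast hr
  have h6 : 1 + 2 * (2 * z) < r + 1 - r * y := by nlinarith
  have h7 : (1 - z) * (1 + 2 * (2 * z)) ≤ L * (r + 1 - r * y) := by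
    apply mul_le_mul h3 h6.le <;> nlinarith
  nlinarith

/-- The upper bound on `t σ` makes the edge count and the main term of `sum_slack` agree to first
order, so the slack is one power of `t` smaller than `t^r`. -/
theorem factorial_mul_sum_slack_le (hH : #H ≤ t ^ r / r.factorial) :
    r.factorial *
      ∑ A ∈ H, (1 + (∏ i ∈ A, t * x i) * ∑ i ∈ A, t * x i - (r + 1) * ∏ i ∈ A, t * x i) ≤
      (2 * r ^ 2 + r * (4 * r ^ 8 + r ^ 2)) * t ^ (r - 1) := by
  have ht0 : 0 < t := by linarith
  have hf : (0 : ℝ) < r.factorial := by positivity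
  rw [h.sum_slack t, mul_sub]
  have h1 := one_sub_div_le_of_le ht (Nat.cast_nonneg r) hlam
  have h2 := h.mul_sum_sq_le ht hr hlam
  have h3 := h.factorial_mul_lam_le_one
  have h3' : 0 ≤ r.factorial * lam := mul_nonneg hf.le h.lam_nonneg
  rw [le_div_iff₀ hf] at hH
  set y := t * ∑ i ∈ V, x i ^ 2
  set L := r.factorial * lam
  set B := 4 * (r : ℝ) ^ 8 + r ^ 2
  have hB : 0 ≤ B / t := by positivity
  have h4 : 1 - 2 * (r : ℝ) ^ 2 / t - r * (B / t) ≤ L * (r + 1 - r * y) := by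
    have h5 : 1 - r * (B / t) ≤ r + 1 - r * y := by
      have := mul_le_mul_of_nonneg_left h2 (Nat.cast_nonneg r : (0 : ℝ) ≤ r)
      linarith
    have h6 : L * (1 - r * (B / t)) ≤ L * (r + 1 - r * y) := by gcongr
    have h7 : L * (r * (B / t)) ≤ 1 * (r * (B / t)) := by gcongr
    linarith
  have h8 : t ^ r = t ^ (r - 1) * t := by
    rw [← pow_succ]
    congr 1
    omega
  calc r.factorial * (#H : ℝ) - r.factorial * (t ^ r * lam * (r + 1 - r * y))
      = r.factorial * (#H : ℝ) - t ^ r * (L * (r + 1 - r * y)) := by simp only [L]; ring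
    _ ≤ t ^ r - t ^ r * (1 - 2 * (r : ℝ) ^ 2 / t - r * (B / t)) := by
      gcongr
      linarith
    _ = _ := by rw [h8]; field_simp; ring

/-- The derivative `r λ` at `k` is spread over link edges each of weight at most `(2r²/t)^(r-1)`, so
there are many of them. -/
theorem le_degree (ht' : 4 * r ^ 2 ≤ t) {k : ι} (hk : k ∈ V) :
    t ^ (r - 1) ≤ 2 * (r - 1).factorial * (2 * r ^ 2) ^ (r - 1) * #{A ∈ H | k ∈ A} := by
  have ht0 : 0 < t := by linarith
  have h1 := one_sub_div_le_of_le ht (Nat.cast_nonneg r) hlam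
  have h2 : (1 : ℝ) / 2 ≤ 1 - 2 * r ^ 2 / t := by
    have : 2 * (r : ℝ) ^ 2 / t ≤ 1 / 2 := by rw [div_le_iff₀ ht0]; linarith
    linarith
  rw [factorial_mul_eq_pred (by omega), ← h.deriv k hk] at h1
  have h3 : ∑ A ∈ H with k ∈ A, ∏ i ∈ A.erase k, x i ≤
      #{A ∈ H | k ∈ A} * (2 * r ^ 2 / t) ^ (r - 1) := by
    rw [← nsmul_eq_mul]
    refine sum_le_card_nsmul _ _ _ fun A hA => ?_
    obtain ⟨hA, hkA⟩ := mem_filter.1 hA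
    have hA' := mem_powersetCard.1 (h.subset hA)
    have hc : #(A.erase k) = r - 1 := by rw [card_erase_of_mem hkA, hA'.2]
    rw [← hc, ← prod_const]
    exact prod_le_prod (fun i hi => h.nonneg i (hA'.1 (mem_of_mem_erase hi))) fun i hi =>
      h.le_two_mul_sq_div ht hr hlam (hA'.1 (mem_of_mem_erase hi))
  have h4 : (1 : ℝ) / 2 ≤
      (r - 1).factorial * (#{A ∈ H | k ∈ A} * (2 * r ^ 2 / t) ^ (r - 1)) := by
    refine (h2.trans h1).trans ?_
    gcongr
  rw [div_pow] at h4
  have h5 : 0 < t ^ (r - 1) := by positivity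
  calc t ^ (r - 1) = 2 * t ^ (r - 1) * (1 / 2) := by ring
    _ ≤ 2 * t ^ (r - 1) * ((r - 1).factorial *
        (#{A ∈ H | k ∈ A} * ((2 * r ^ 2) ^ (r - 1) / t ^ (r - 1)))) := by gcongr
    _ = _ := by field_simp

end Bounds

end IsStationary

end FranklFuredi

namespace FranklFuredi

/-! ### Counting low vertices and non-edges. -/

theorem card_powersetCard_filter_pair_le {ι : Type*} [DecidableEq ι] (W : Finset ι) {r : ℕ}
    {v w : ι} (hvw : v ≠ w) :
    #{A ∈ W.powersetCard r | v ∈ A ∧ w ∈ A} ≤ #W ^ (r - 2) := by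
  refine le_trans ?_ (Nat.choose_le_pow #W (r - 2))
  rw [← card_powersetCard]
  refine card_le_card_of_injOn (fun A => (A.erase v).erase w) ?_ ?_
  · intro A hA
    simp only [coe_filter, mem_powersetCard, Set.mem_ofPred_eq] at hA
    obtain ⟨⟨hAW, hAr⟩, hv, hw⟩ := hA
    simp only [mem_coe, mem_powersetCard]
    refine ⟨((erase_subset _ _).trans (erase_subset _ _)).trans hAW, ?_⟩
    rw [card_erase_of_mem (mem_erase.2 ⟨hvw.symm, hw⟩), card_erase_of_mem hv, hAr]
    rfl
  · intro A hA B hB hAB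
    simp only [coe_filter, mem_powersetCard, Set.mem_ofPred_eq] at hA hB
    have hAB' : (A.erase v).erase w = (B.erase v).erase w := hAB
    rw [← insert_erase hA.2.1, ← insert_erase hB.2.1,
      ← insert_erase (mem_erase.2 ⟨hvw.symm, hA.2.2⟩ : w ∈ A.erase v),
      ← insert_erase (mem_erase.2 ⟨hvw.symm, hB.2.2⟩ : w ∈ B.erase v), hAB']

namespace IsStationary

variable {ι : Type*} [DecidableEq ι] {r : ℕ} {V : Finset ι} {x : ι → ℝ}
  {H : Finset (Finset ι)} {lam : ℝ} (h : IsStationary r V x H lam)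
  {t : ℝ} (ht : 1 ≤ t) (hr : 2 ≤ r)
  (hlam : 1 - (r : ℝ) * (r - 1) / 2 / t - r ^ 2 / t ^ 2 ≤ r.factorial * lam)
include h ht hr hlam

/-- Only boundedly many vertices have weight much below the average. -/
theorem card_low_le (ht' : 4 * r ^ 2 ≤ t) (hH : #H ≤ t ^ r / r.factorial) :
    #{k ∈ V | t * x k ≤ 1 / 2} ≤
      48 * (r + 1) * (2 * r ^ 2) ^ (r - 1) * (2 * r ^ 2 + r * (4 * r ^ 8 + r ^ 2) : ℝ) := by
  have ht0 : 0 < t := by linarith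
  set S : Finset ι → ℝ := fun A =>
    1 + (∏ i ∈ A, t * x i) * ∑ i ∈ A, t * x i - (r + 1) * ∏ i ∈ A, t * x i with hS
  set C : ℝ := 2 * r ^ 2 + r * (4 * r ^ 8 + r ^ 2)
  set low := {k ∈ V | t * x k ≤ 1 / 2}
  have hSnn : ∀ A ∈ H, 0 ≤ S A := fun A hA => h.slack_nonneg ht0.le hA
  have h1 : (r.factorial : ℝ) * ∑ A ∈ H, S A ≤ C * t ^ (r - 1) :=
    h.factorial_mul_sum_slack_le ht hr hlam hH
  have h2 : ∑ k ∈ V, ∑ A ∈ H with k ∈ A, S A = r * ∑ A ∈ H, S A := by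
    rw [← sum_sum_mem_comm fun A hA => (mem_powersetCard.1 (h.subset hA)).1, mul_sum]
    refine sum_congr rfl fun A hA => ?_
    rw [sum_const, (mem_powersetCard.1 (h.subset hA)).2, nsmul_eq_mul]
  have h3 : ∀ k ∈ low, (#{A ∈ H | k ∈ A} : ℝ) ≤ 24 * (r + 1) * ∑ A ∈ H with k ∈ A, S A := by
    intro k hk
    have : (#{A ∈ H | k ∈ A} : ℝ) * (1 / (24 * (r + 1))) ≤ ∑ A ∈ H with k ∈ A, S A := by
      rw [← nsmul_eq_mul]
      refine card_nsmul_le_sum _ _ _ fun A hA => ?_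
      obtain ⟨hA, hkA⟩ := mem_filter.1 hA
      exact h.le_slack ht0.le hA hkA (mem_filter.1 hk).2
    rw [mul_one_div, div_le_iff₀ (by positivity)] at this
    linarith
  -- Each low vertex has degree of order at least `t^(r-1)` and so carries slack of that order,
  -- which is also the order of the bound on the total.
  have h4 : (#low : ℝ) * t ^ (r - 1) ≤ 2 * (r - 1).factorial * (2 * r ^ 2) ^ (r - 1) *
      (24 * (r + 1) * (r * ∑ A ∈ H, S A)) := by
    calc (#low : ℝ) * t ^ (r - 1)
        ≤ ∑ k ∈ low, 2 * (r - 1).factorial * (2 * r ^ 2) ^ (r - 1) * (#{A ∈ H | k ∈ A} : ℝ) := by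
          rw [← nsmul_eq_mul]
          exact card_nsmul_le_sum _ _ _ fun k hk =>
            h.le_degree ht hr hlam ht' (mem_filter.1 hk).1
      _ ≤ ∑ k ∈ low, 2 * (r - 1).factorial * (2 * r ^ 2) ^ (r - 1) *
            (24 * (r + 1) * ∑ A ∈ H with k ∈ A, S A) := by
          gcongr with k hk
          exact h3 k hk
      _ ≤ ∑ k ∈ V, 2 * (r - 1).factorial * (2 * r ^ 2) ^ (r - 1) *
            (24 * (r + 1) * ∑ A ∈ H with k ∈ A, S A) := by
          refine sum_le_sum_of_subset_of_nonneg (filter_subset _ _) fun k _ _ => ?_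
          have : 0 ≤ ∑ A ∈ H with k ∈ A, S A :=
            sum_nonneg fun A hA => hSnn A (mem_filter.1 hA).1
          positivity
      _ = _ := by rw [← mul_sum, ← mul_sum, h2]
  have h5 : 2 * ((r - 1).factorial : ℝ) * (2 * r ^ 2) ^ (r - 1) *
      (24 * (r + 1) * (r * ∑ A ∈ H, S A)) =
      48 * (r + 1) * (2 * r ^ 2) ^ (r - 1) * (r.factorial * ∑ A ∈ H, S A) := by
    rw [factorial_mul_eq_pred (by omega)]
    ring
  rw [h5] at h4
  refine le_of_mul_le_mul_right (h4.trans ?_) (by positivity : 0 < t ^ (r - 1))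
  rw [mul_assoc _ C]
  gcongr

/-- After scaling by `t`, each such non-edge weighs at least `2^(-r)`, while all non-edges together
weigh `t^r (e_r(x) - λ) = O(t^(r-2))`. -/
theorem card_missing_high_le (ht' : 4 * r ^ 2 ≤ t) (hH : #H ≤ t ^ r / r.factorial) :
    #{A ∈ V.powersetCard r \ H | ∀ k ∈ A, 1 / 2 ≤ t * x k} ≤
      2 ^ r * (4 * r ^ 4 + 4 * r ^ 8 + r ^ 2 : ℝ) * t ^ (r - 2) := by
  have ht0 : 0 < t := by linarith
  set M := {A ∈ V.powersetCard r \ H | ∀ k ∈ A, 1 / 2 ≤ t * x k}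
  have hf : (1 : ℝ) ≤ r.factorial := by exact_mod_cast Nat.one_le_iff_ne_zero.2 r.factorial_ne_zero
  have h1 : (#M : ℝ) * (1 / 2) ^ r ≤ t ^ r * (esym x r V - lam) := by
    have h2 : (#M : ℝ) * (1 / 2) ^ r ≤ ∑ A ∈ M, ∏ i ∈ A, t * x i := by
      rw [← nsmul_eq_mul]
      refine card_nsmul_le_sum _ _ _ fun A hA => ?_
      obtain ⟨hA, hAx⟩ := mem_filter.1 hA
      have hc := (mem_powersetCard.1 (mem_sdiff.1 hA).1).2
      calc (1 / 2 : ℝ) ^ r = ∏ i ∈ A, 1 / 2 := by rw [prod_const, hc]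
        _ ≤ _ := prod_le_prod (by simp) hAx
    refine h2.trans ?_
    calc ∑ A ∈ M, ∏ i ∈ A, t * x i ≤ ∑ A ∈ V.powersetCard r \ H, ∏ i ∈ A, t * x i := by
          refine sum_le_sum_of_subset_of_nonneg (filter_subset _ _) fun A hA _ => ?_
          exact Finset.prod_nonneg fun i hi =>
            mul_nonneg ht0.le (h.nonneg_of_mem (mem_sdiff.1 hA).1 hi)
      _ = ∑ A ∈ V.powersetCard r \ H, t ^ r * ∏ i ∈ A, x i := by
          refine sum_congr rfl fun A hA => ?_
          rw [prod_mul_distrib, prod_const, (mem_powersetCard.1 (mem_sdiff.1 hA).1).2]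
      _ = t ^ r * (esym x r V - lam) := by
          rw [← mul_sum, esym, ← h.sum_prod, ← sum_sdiff h.subset, add_sub_cancel_right]
  have h3 : esym x r V - lam ≤ (4 * r ^ 4 + 4 * r ^ 8 + r ^ 2) / t ^ 2 := by
    have h4 := h.factorial_mul_esym_sub_lam_le ht hr hlam
    have h5 := h.le_mul_sum_sq ht hr hlam ht' hH
    have h6 : 1 / t - ∑ i ∈ V, x i ^ 2 ≤ 4 * r ^ 2 / t ^ 2 := by
      have : t * (1 / t - ∑ i ∈ V, x i ^ 2) ≤ t * (4 * r ^ 2 / t ^ 2) := by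
        have e1 : t * (1 / t - ∑ i ∈ V, x i ^ 2) = 1 - t * ∑ i ∈ V, x i ^ 2 := by field_simp
        have e2 : t * (4 * (r : ℝ) ^ 2 / t ^ 2) = 4 * r ^ 2 / t := by field_simp
        rw [e1, e2]
        linarith
      exact le_of_mul_le_mul_left this ht0
    have hr' : (2 : ℝ) ≤ r := by exact_mod_cast hr
    have h7 : (r : ℝ) * (r - 1) / 2 * (1 / t - ∑ i ∈ V, x i ^ 2) ≤
        r ^ 2 * (4 * r ^ 2 / t ^ 2) := by
      refine (mul_le_mul_of_nonneg_left h6 (by nlinarith)).trans ?_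
      gcongr
      nlinarith
    have h8 : esym x r V - lam ≤ r.factorial * (esym x r V - lam) := by
      have := h.lam_le_esym
      nlinarith
    calc esym x r V - lam ≤ _ := h8.trans h4
      _ ≤ r ^ 2 * (4 * r ^ 2 / t ^ 2) + (4 * r ^ 8 + r ^ 2) / t ^ 2 := by gcongr
      _ = _ := by ring
  have h9 : t ^ r = t ^ (r - 2) * t ^ 2 := by
    rw [← pow_add]
    congr 1
    omega
  have h10 : (#M : ℝ) = 2 ^ r * (#M * (1 / 2) ^ r) := by
    rw [one_div, inv_pow]
    field_simp
  rw [h10]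
  calc 2 ^ r * (#M * (1 / 2) ^ r) ≤ 2 ^ r * (t ^ r * (esym x r V - lam)) := by gcongr
    _ ≤ 2 ^ r * (t ^ r * ((4 * r ^ 4 + 4 * r ^ 8 + r ^ 2) / t ^ 2)) := by gcongr
    _ = _ := by rw [h9]; field_simp

/-- The weight of `v` may be tiny, so its non-edges are weighed without it: the missing link weight
is `e_{r-1}(V \ v) - r λ = O(1/t)`, and scaling multiplies it by `t^(r-1)`. -/
theorem card_missing_at_le {v : ι} (hv : v ∈ V) :
    #{A ∈ V.powersetCard r \ H | v ∈ A ∧ ∀ k ∈ A.erase v, 1 / 2 ≤ t * x k} ≤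
      2 ^ (r - 1) * (2 * r ^ 2 : ℝ) * t ^ (r - 2) := by
  have ht0 : 0 < t := by linarith
  set M := {A ∈ V.powersetCard r \ H | v ∈ A ∧ ∀ k ∈ A.erase v, 1 / 2 ≤ t * x k}
  have hf : (1 : ℝ) ≤ (r - 1).factorial := by
    exact_mod_cast Nat.one_le_iff_ne_zero.2 (r - 1).factorial_ne_zero
  have hcard : ∀ A ∈ V.powersetCard r \ H, v ∈ A → #(A.erase v) = r - 1 := by
    intro A hA hvA
    rw [card_erase_of_mem hvA, (mem_powersetCard.1 (mem_sdiff.1 hA).1).2]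
  set D := esym x (r - 1) (V.erase v) - r * lam with hD
  have hnn : ∀ A ∈ V.powersetCard r \ H, ∀ i ∈ A.erase v, 0 ≤ x i := fun A hA i hi =>
    h.nonneg_of_mem (mem_sdiff.1 hA).1 (mem_of_mem_erase hi)
  have h1 : (#M : ℝ) * (1 / 2) ^ (r - 1) ≤ t ^ (r - 1) * D := by
    have h2 : (#M : ℝ) * (1 / 2) ^ (r - 1) ≤ ∑ A ∈ M, ∏ i ∈ A.erase v, t * x i := by
      rw [← nsmul_eq_mul]
      refine card_nsmul_le_sum _ _ _ fun A hA => ?_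
      obtain ⟨hA, hvA, hAx⟩ := mem_filter.1 hA
      calc (1 / 2 : ℝ) ^ (r - 1) = ∏ i ∈ A.erase v, 1 / 2 := by rw [prod_const, hcard A hA hvA]
        _ ≤ _ := prod_le_prod (by simp) hAx
    refine h2.trans ?_
    calc ∑ A ∈ M, ∏ i ∈ A.erase v, t * x i
        ≤ ∑ A ∈ V.powersetCard r \ H with v ∈ A, ∏ i ∈ A.erase v, t * x i := by
          refine sum_le_sum_of_subset_of_nonneg
            (monotone_filter_right _ fun A _ hA => hA.1) fun A hA _ => ?_
          exact Finset.prod_nonneg fun i hi => mul_nonneg ht0.le (hnn A (mem_filter.1 hA).1 i hi)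
      _ = ∑ A ∈ V.powersetCard r \ H with v ∈ A, t ^ (r - 1) * ∏ i ∈ A.erase v, x i := by
          refine sum_congr rfl fun A hA => ?_
          rw [prod_mul_distrib, prod_const, hcard A (mem_filter.1 hA).1 (mem_filter.1 hA).2]
      _ = t ^ (r - 1) * D := by
          rw [← mul_sum, h.sum_not_mem_eq hv (by omega)]
  have hD0 : 0 ≤ D := by
    rw [hD, ← h.sum_not_mem_eq hv (by omega)]
    exact sum_nonneg fun A hA => Finset.prod_nonneg (hnn A (mem_filter.1 hA).1)
  have h3 : D ≤ 2 * r ^ 2 / t := by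
    have h4 := one_sub_div_le_of_le ht (Nat.cast_nonneg r) hlam
    rw [factorial_mul_eq_pred (by omega)] at h4
    have h5 : ((r - 1).factorial : ℝ) * esym x (r - 1) (V.erase v) ≤ 1 := by
      refine (mul_le_mul_of_nonneg_left (esym_mono h.nonneg (erase_subset v V) _)
        (by positivity)).trans ?_
      simpa [h.sum_eq] using factorial_mul_esym_le (r - 1) h.nonneg
    have h6 : D ≤ (r - 1).factorial * D := le_mul_of_one_le_left hD0 hf
    rw [hD, mul_sub, ← hD] at h6
    linarith
  have h9 : t ^ (r - 1) = t ^ (r - 2) * t := by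
    rw [← pow_succ]
    congr 1
    omega
  have h10 : (#M : ℝ) = 2 ^ (r - 1) * (#M * (1 / 2) ^ (r - 1)) := by
    rw [one_div, inv_pow]
    field_simp
  rw [h10]
  calc 2 ^ (r - 1) * (#M * (1 / 2) ^ (r - 1)) ≤ 2 ^ (r - 1) * (t ^ (r - 1) * D) := by gcongr
    _ ≤ 2 ^ (r - 1) * (t ^ (r - 1) * (2 * r ^ 2 / t)) := by gcongr
    _ = _ := by rw [h9]; field_simp

end IsStationary

/-- A stationary weighting on at least `t` vertices whose Lagrangian is almost that of the clique
on `t` vertices forces almost as many edges as in that clique. -/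
theorem exists_choose_sub_le_card (r : ℕ) (hr : 2 ≤ r) :
    ∃ C : ℝ, 0 < C ∧ ∀ {ι : Type} [DecidableEq ι] {V : Finset ι} {x : ι → ℝ}
      {H : Finset (Finset ι)} {lam : ℝ} {t : ℕ}, IsStationary r V x H lam → 1 ≤ t → t ≤ #V →
      1 - (r : ℝ) * (r - 1) / 2 / t - r ^ 2 / t ^ 2 ≤ r.factorial * lam →
      (t.choose r : ℝ) - C * t ^ (r - 2) ≤ #H := by
  set ℓ : ℝ := 48 * (r + 1) * (2 * r ^ 2) ^ (r - 1) * (2 * r ^ 2 + r * (4 * r ^ 8 + r ^ 2)) with hℓ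
  set a : ℝ := 2 ^ r * (4 * r ^ 4 + 4 * r ^ 8 + r ^ 2) with ha
  set b : ℝ := 2 ^ (r - 1) * (2 * r ^ 2) with hb
  have hr0 : (0 : ℝ) < r := by exact_mod_cast (by omega : 0 < r)
  -- `(4r²)²` settles `t < 4r²`; `a`, `ℓ b` and `ℓ ℓ` pay for non-edges with zero, one and at least
  -- two low vertices.
  refine ⟨(4 * r ^ 2) ^ 2 + (a + ℓ * b + ℓ * ℓ), by positivity, ?_⟩
  intro ι _ V x H lam t h ht htV hlam
  have ht1 : (1 : ℝ) ≤ t := by exact_mod_cast ht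
  have hpow : (t : ℝ) ^ r = t ^ (r - 2) * t ^ 2 := by
    rw [← pow_add]
    congr 1
    omega
  have hP : 0 < (t : ℝ) ^ (r - 2) := by positivity
  rw [add_mul]
  have hA : 0 ≤ (4 * (r : ℝ) ^ 2) ^ 2 * t ^ (r - 2) := by positivity
  have hB : 0 ≤ (a + ℓ * b + ℓ * ℓ) * (t : ℝ) ^ (r - 2) := by positivity
  have hcH : (0 : ℝ) ≤ #H := Nat.cast_nonneg _
  by_cases ht' : 4 * (r : ℝ) ^ 2 ≤ t
  swap
  · push Not at ht'
    have h1 : (t.choose r : ℝ) ≤ t ^ r := by exact_mod_cast Nat.choose_le_pow t r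
    have h2 : (t : ℝ) ^ (r - 2) * t ^ 2 ≤ t ^ (r - 2) * (4 * (r : ℝ) ^ 2) ^ 2 := by gcongr
    linarith
  by_cases hH : (#H : ℝ) ≤ t ^ r / r.factorial
  swap
  · have h1 : (t.choose r : ℝ) ≤ t ^ r / r.factorial := Nat.choose_le_pow_div r t
    linarith
  -- `V` may be much larger than `t`; restricting to `t` vertices keeps the `r`-sets through two low
  -- vertices down to `t^(r-2)` per pair.
  obtain ⟨W, hWV, hWt⟩ := exists_subset_card_eq htV
  set low := {k ∈ V | (t : ℝ) * x k ≤ 1 / 2} with hlow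
  have hlow_card : (#low : ℝ) ≤ ℓ := h.card_low_le ht1 hr hlam ht' hH
  set M₀ := {A ∈ V.powersetCard r \ H | ∀ k ∈ A, 1 / 2 ≤ (t : ℝ) * x k} with hM₀
  set M₁ : ι → Finset (Finset ι) := fun v =>
    {A ∈ V.powersetCard r \ H | v ∈ A ∧ ∀ k ∈ A.erase v, 1 / 2 ≤ (t : ℝ) * x k} with hM₁
  set M₂ : ι × ι → Finset (Finset ι) := fun p =>
    {A ∈ W.powersetCard r | p.1 ∈ A ∧ p.2 ∈ A} with hM₂
  have hcover : W.powersetCard r ⊆ H ∪ M₀ ∪ low.biUnion M₁ ∪ low.offDiag.biUnion M₂ := by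
    intro A hA
    have hAV : A ∈ V.powersetCard r := powersetCard_mono hWV hA
    have hAsub := (mem_powersetCard.1 hAV).1
    by_cases hAH : A ∈ H
    · simp [hAH]
    have hAM : A ∈ V.powersetCard r \ H := mem_sdiff.2 ⟨hAV, hAH⟩
    by_cases h0 : ∀ k ∈ A, 1 / 2 ≤ (t : ℝ) * x k
    · have : A ∈ M₀ := mem_filter.2 ⟨hAM, h0⟩
      simp [this]
    push Not at h0
    obtain ⟨v, hvA, hv⟩ := h0
    have hvlow : v ∈ low := mem_filter.2 ⟨hAsub hvA, hv.le⟩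
    by_cases h1 : ∀ k ∈ A.erase v, 1 / 2 ≤ (t : ℝ) * x k
    · have : A ∈ low.biUnion M₁ := mem_biUnion.2 ⟨v, hvlow, mem_filter.2 ⟨hAM, hvA, h1⟩⟩
      exact mem_union_left _ (mem_union_right _ this)
    push Not at h1
    obtain ⟨w, hwA, hw⟩ := h1
    have hwlow : w ∈ low := mem_filter.2 ⟨hAsub (mem_of_mem_erase hwA), hw.le⟩
    refine mem_union_right _ (mem_biUnion.2 ⟨(v, w), ?_, ?_⟩)
    · exact mem_offDiag.2 ⟨hvlow, hwlow, (ne_of_mem_erase hwA).symm⟩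
    · exact mem_filter.2 ⟨hA, hvA, mem_of_mem_erase hwA⟩
  have h0 : (#M₀ : ℝ) ≤ a * t ^ (r - 2) := h.card_missing_high_le ht1 hr hlam ht' hH
  have h1 : (#(low.biUnion M₁) : ℝ) ≤ ℓ * (b * t ^ (r - 2)) := by
    calc (#(low.biUnion M₁) : ℝ) ≤ ∑ v ∈ low, (#(M₁ v) : ℝ) := by
          exact_mod_cast card_biUnion_le
      _ ≤ #low • (b * (t : ℝ) ^ (r - 2)) := sum_le_card_nsmul _ _ _ fun v hv =>
          h.card_missing_at_le ht1 hr hlam (mem_filter.1 hv).1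
      _ ≤ ℓ * (b * t ^ (r - 2)) := by
          rw [nsmul_eq_mul]
          gcongr
  have h2 : (#(low.offDiag.biUnion M₂) : ℝ) ≤ ℓ * ℓ * t ^ (r - 2) := by
    calc (#(low.offDiag.biUnion M₂) : ℝ) ≤ ∑ p ∈ low.offDiag, (#(M₂ p) : ℝ) := by
          exact_mod_cast card_biUnion_le
      _ ≤ #low.offDiag • ((t : ℝ) ^ (r - 2)) := sum_le_card_nsmul _ _ _ fun p hp => by
          have := card_powersetCard_filter_pair_le W (r := r) (mem_offDiag.1 hp).2.2
          rw [hWt] at this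
          exact_mod_cast this
      _ ≤ (#low * #low : ℝ) * t ^ (r - 2) := by
          rw [nsmul_eq_mul]
          gcongr
          rw [offDiag_card]
          exact_mod_cast Nat.sub_le _ _
      _ ≤ _ := by gcongr
  have h3 : (t.choose r : ℝ) ≤ #H + #M₀ + #(low.biUnion M₁) + #(low.offDiag.biUnion M₂) := by
    have h4 := card_le_card hcover
    rw [card_powersetCard, hWt] at h4
    have h5 := card_union_le (H ∪ M₀ ∪ low.biUnion M₁) (low.offDiag.biUnion M₂)
    have h6 := card_union_le (H ∪ M₀) (low.biUnion M₁)
    have h7 := card_union_le H M₀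
    exact_mod_cast (by omega : t.choose r ≤ _)
  linarith

end FranklFuredi

namespace FranklFuredi

/-! ### Optimal weightings are stationary; cliques inside colex segments. -/

theorem lagrangePoly_smul {r : ℕ} {H : Finset (Finset ℕ)} (hH : IsRGraph r H) (c : ℝ)
    (y : ℕ →₀ ℝ) : lagrangePoly H (c • y) = c ^ r * lagrangePoly H y := by
  rw [lagrangePoly, lagrangePoly, mul_sum]
  refine sum_congr rfl fun A hA => ?_
  simp [prod_mul_distrib, hH A hA]

theorem lagrangePoly_add_single (H : Finset (Finset ℕ)) (y : ℕ →₀ ℝ) (k : ℕ) (ε : ℝ) :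
    lagrangePoly H (y + Finsupp.single k ε) =
      lagrangePoly H y + ε * ∑ A ∈ H with k ∈ A, ∏ i ∈ A.erase k, y i := by
  rw [lagrangePoly, lagrangePoly, sum_filter, mul_sum, ← sum_add_distrib]
  refine sum_congr rfl fun A _ => ?_
  have herase : ∀ i ∈ A.erase k, (y + Finsupp.single k ε) i = y i := fun i hi => by
    simp [Finsupp.single_eq_of_ne (ne_of_mem_erase hi)]
  split_ifs with hk
  · rw [← mul_prod_erase A _ hk, ← mul_prod_erase A (fun i => y i) hk, prod_congr rfl herase]
    simp
    ring
  · rw [← erase_eq_of_notMem hk, prod_congr rfl herase]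
    simp

theorem lagrangePoly_le_lagrangian (H : Finset (Finset ℕ)) {y : ℕ →₀ ℝ} (hy : y ∈ simplex) :
    lagrangePoly H y ≤ lagrangian H :=
  (isGreatest_lagrangian H).2 ⟨y, hy, rfl⟩

theorem lagrangePoly_le_lagrangian_mul_pow {r : ℕ} {H : Finset (Finset ℕ)} (hH : IsRGraph r H)
    {y : ℕ →₀ ℝ} (hy : ∀ i, 0 ≤ y i) {s : ℝ} (hs : ∑ i ∈ y.support, y i = s) (hs0 : 0 < s) :
    lagrangePoly H y ≤ lagrangian H * s ^ r := by
  have hmem : s⁻¹ • y ∈ simplex := by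
    refine ⟨fun i => mul_nonneg (by positivity) (hy i), ?_⟩
    rw [Finsupp.support_smul_eq (by positivity)]
    simp only [Finsupp.smul_apply, smul_eq_mul]
    rw [← mul_sum, hs, inv_mul_cancel₀ hs0.ne']
  have h1 := lagrangePoly_le_lagrangian H hmem
  rwa [lagrangePoly_smul hH, inv_pow, inv_mul_le_iff₀ (by positivity), mul_comm] at h1

/-- The Lagrange multiplier equations for an optimal weighting. -/
theorem sum_prod_erase_eq {r : ℕ} {H : Finset (Finset ℕ)} (hH : IsRGraph r H) {x : ℕ →₀ ℝ}
    (hx : x ∈ simplex) (hmax : lagrangePoly H x = lagrangian H) {k : ℕ} (hk : x k ≠ 0) :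
    ∑ A ∈ H with k ∈ A, ∏ i ∈ A.erase k, x i = r * lagrangian H := by
  set D := ∑ A ∈ H with k ∈ A, ∏ i ∈ A.erase k, x i with hD
  have hk0 : 0 < x k := lt_of_le_of_ne (hx.1 k) hk.symm
  have hk1 : x k ≤ 1 := by
    rw [← hx.2]
    exact single_le_sum (f := fun i => x i) (fun i _ => hx.1 i) (Finsupp.mem_support_iff.2 hk)
  -- Homogeneity allows perturbing `x k` alone, without restoring total weight `1`. Since `x k > 0`,
  -- both signs of `ε` occur, so the derivative at the minimum `ε = 0` vanishes.
  have hge : ∀ ε : ℝ, -x k < ε → 0 ≤ lagrangian H * (1 + ε) ^ r - lagrangian H - ε * D := by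
    intro ε hε
    have hnn : ∀ i, 0 ≤ (x + Finsupp.single k ε) i := by
      intro i
      rcases eq_or_ne i k with rfl | hi
      · simp only [Finsupp.add_apply, Finsupp.single_eq_same]
        linarith
      · simp [Finsupp.single_eq_of_ne hi, hx.1 i]
    have hsum : ∑ i ∈ (x + Finsupp.single k ε).support, (x + Finsupp.single k ε) i = 1 + ε := by
      change (x + Finsupp.single k ε).sum (fun _ a => a) = 1 + ε
      rw [Finsupp.sum_add_index' (fun _ => rfl) (fun _ _ _ => rfl), Finsupp.sum_single_index rfl]
      congr 1
      exact hx.2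
    have := lagrangePoly_le_lagrangian_mul_pow hH hnn hsum (by linarith)
    rw [lagrangePoly_add_single, hmax] at this
    linarith
  have hmin : IsLocalMin (fun ε : ℝ => lagrangian H * (1 + ε) ^ r - lagrangian H - ε * D) 0 := by
    filter_upwards [lt_mem_nhds (neg_lt_zero.2 hk0)] with ε hε
    simpa using hge ε hε
  have hder : HasDerivAt (fun ε : ℝ => lagrangian H * (1 + ε) ^ r - lagrangian H - ε * D)
      (lagrangian H * (r * (1 + 0) ^ (r - 1) * 1) - 1 * D) 0 :=
    (((((hasDerivAt_id' (0 : ℝ)).const_add 1).fun_pow r).const_mul _).sub_const _).sub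
      ((hasDerivAt_id' (0 : ℝ)).mul_const D)
  have := hmin.hasDerivAt_eq_zero hder
  simp only [add_zero, one_pow, mul_one, one_mul] at this
  linarith

theorem isStationary_of_lagrangePoly_eq {r : ℕ} {H : Finset (Finset ℕ)} (hH : IsRGraph r H)
    {x : ℕ →₀ ℝ} (hx : x ∈ simplex) (hmax : lagrangePoly H x = lagrangian H) :
    IsStationary r x.support x {A ∈ H | A ⊆ x.support} (lagrangian H) where
  nonneg i _ := hx.1 i
  sum_eq := hx.2
  subset A hA := mem_powersetCard.2 ⟨(mem_filter.1 hA).2, hH A (mem_filter.1 hA).1⟩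
  sum_prod := by
    rw [← hmax, lagrangePoly]
    refine sum_filter_of_ne fun A _ hA i hi => ?_
    exact Finsupp.mem_support_iff.2 (prod_ne_zero_iff.1 hA i hi)
  deriv k hk := by
    rw [← sum_prod_erase_eq hH hx hmax (Finsupp.mem_support_iff.1 hk), filter_comm]
    refine sum_filter_of_ne fun A hA hA0 i hi => ?_
    rcases eq_or_ne i k with rfl | hik
    · exact hk
    · exact Finsupp.mem_support_iff.2 (prod_ne_zero_iff.1 hA0 i (mem_erase.2 ⟨hik, hi⟩))

/-- Both families are colex initial segments, hence comparable, and the sizes decide the direction.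
-/
theorem powersetCard_range_subset_colexInit {r m s : ℕ} (hr : 1 ≤ r) (hm : s.choose r ≤ m) :
    (range s).powersetCard r ⊆ colexInit m r := by
  have hseg : Colex.IsInitSeg ((range s).powersetCard r) r := by
    refine ⟨fun A hA => (mem_powersetCard.1 hA).2, ?_⟩
    rintro A B hA ⟨hBA, hB⟩
    rw [mem_powersetCard] at hA ⊢
    exact ⟨fun b hb => mem_range.2
      (Colex.forall_lt_mono hBA.le (fun c hc => mem_range.1 (hA.1 hc)) b hb), hB⟩
  rcases hseg.total (colexInit_isInitSeg m r) with h | h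
  · exact h
  · refine (eq_of_subset_of_card_le h ?_).ge
    rwa [card_powersetCard, card_range, card_colexInit m r hr]

theorem esym_range_le_lagrangian_colexInit {r m s : ℕ} (hr : 1 ≤ r) (hm : s.choose r ≤ m)
    {y : ℕ → ℝ} (hy : ∀ i, 0 ≤ y i) (hys : ∀ i, y i ≠ 0 → i ∈ range s)
    (hsum : ∑ i ∈ range s, y i = 1) : esym y r (range s) ≤ lagrangian (colexInit m r) := by
  have hmem : Finsupp.onFinset (range s) y hys ∈ simplex := by
    refine ⟨hy, ?_⟩
    rw [← hsum]
    exact sum_subset Finsupp.support_onFinset_subset fun i _ hi => Finsupp.notMem_support_iff.1 hi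
  refine le_trans ?_ (lagrangePoly_le_lagrangian _ hmem)
  exact sum_le_sum_of_subset_of_nonneg (powersetCard_range_subset_colexInit hr hm)
    fun A _ _ => prod_nonneg fun i _ => hy i

/-- A weighting on at most `s` vertices does not beat the clique on `s` vertices. -/
theorem esym_le_lagrangian_colexInit {r m s : ℕ} (hr : 1 ≤ r) (hm : s.choose r ≤ m)
    {V : Finset ℕ} (hV : #V ≤ s) {x : ℕ → ℝ} (hx : ∀ i, 0 ≤ x i) (hsum : ∑ i ∈ V, x i = 1) :
    esym x r V ≤ lagrangian (colexInit m r) := by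
  set n := #V with hn
  set g : Fin n ↪ ℕ := (V.orderEmbOfFin hn.symm).toEmbedding with hg
  have hVg : univ.map g = V := by
    ext i
    simp only [mem_map, mem_univ, true_and, hg]
    have := Finset.range_orderEmbOfFin V hn.symm
    rw [← mem_coe, ← this]
    rfl
  set y : ℕ → ℝ := fun i => if h : i < n then x (g ⟨i, h⟩) else 0 with hy
  have hyval : ∀ i : Fin n, y (Fin.valEmbedding i) = x (g i) := fun i => by simp [hy]
  have hrange : (univ : Finset (Fin n)).map Fin.valEmbedding = range n := by
    ext i
    simp only [mem_map, mem_univ, true_and, mem_range]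
    exact ⟨fun ⟨a, ha⟩ => ha ▸ a.2, fun h => ⟨⟨i, h⟩, rfl⟩⟩
  have hy0 : ∀ i, 0 ≤ y i := fun i => by
    simp only [hy]
    split_ifs
    · exact hx _
    · exact le_rfl
  have hyn : ∀ i, y i ≠ 0 → i ∈ range n := fun i hi => by
    by_contra h
    exact hi (dif_neg (by simpa using h))
  have hns : range n ⊆ range s := range_mono hV
  have h1 : esym x r V = esym y r (range n) := by
    rw [← hVg, ← hrange, esym_map, esym_map]
    simp only [hyval]
  have h2 : ∑ i ∈ range s, y i = 1 := by
    rw [← sum_subset hns fun i _ hi => not_not.1 fun h => hi (hyn i h), ← hsum, ← hVg, ← hrange,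
      sum_map, sum_map]
    simp only [hyval]
  rw [h1]
  exact (esym_mono (fun i _ => hy0 i) hns r).trans
    (esym_range_le_lagrangian_colexInit hr hm hy0 (fun i hi => hns (hyn i hi)) h2)

/-- Uniform weights on `s` vertices have `σ = 1/s`; the lower Bonferroni bound applies. -/
theorem le_factorial_mul_lagrangian_colexInit {r m s : ℕ} (hr : 1 ≤ r) (hs : 1 ≤ s)
    (hm : s.choose r ≤ m) :
    1 - (r : ℝ) * (r - 1) / 2 / s ≤ r.factorial * lagrangian (colexInit m r) := by
  have hs0 : (0 : ℝ) < s := by exact_mod_cast hs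
  set y : ℕ → ℝ := fun i => if i ∈ range s then 1 / (s : ℝ) else 0 with hy
  have hy0 : ∀ i, 0 ≤ y i := fun i => by
    simp only [hy]
    split_ifs <;> positivity
  have hyr : ∀ i ∈ range s, y i = 1 / s := fun i hi => if_pos hi
  have hsum : ∑ i ∈ range s, y i = 1 := by
    rw [sum_congr rfl hyr]
    simp [hs0.ne']
  have hsq : ∑ i ∈ range s, y i ^ 2 = 1 / s := by
    rw [sum_congr rfl fun i hi => by rw [hyr i hi]]
    simp only [sum_const, card_range, nsmul_eq_mul]
    field_simp
  have h1 := le_factorial_mul_esym (fun i _ => hy0 i) hsum r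
  rw [hsq, mul_one_div] at h1
  refine h1.trans (mul_le_mul_of_nonneg_left ?_ (by positivity))
  exact esym_range_le_lagrangian_colexInit hr hm hy0
    (fun i hi => not_not.1 fun h => hi (if_neg h)) hsum

end FranklFuredi

/-! ### The main theorem. -/

theorem theorem1p2 (r : ℕ) (hr : 4 ≤ r) :
    ∃ γ : ℝ, 0 < γ ∧ ∀ t m : ℕ, 1 ≤ t →
      (t - 1).choose r ≤ m →
      (m : ℝ) ≤ (t.choose r : ℝ) - γ * (t : ℝ) ^ (r - 2) →
      IsGreatest
        {l : ℝ | ∃ H : Finset (Finset ℕ),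
          FranklFuredi.IsRGraph r H ∧ #H = m ∧ FranklFuredi.lagrangian H = l}
        (FranklFuredi.lagrangian (FranklFuredi.colexInit m r)) := by
  obtain ⟨C, hC0, hC⟩ := FranklFuredi.exists_choose_sub_le_card r (by omega)
  -- The extra `1` makes the final comparison of edge counts strict.
  refine ⟨C + 1, by positivity, fun t m ht hmt hm => ⟨⟨_, fun A hA =>
    (FranklFuredi.colexInit_isInitSeg m r).1 hA, FranklFuredi.card_colexInit m r (by omega), rfl⟩,
    ?_⟩⟩
  rintro _ ⟨H, hH, hHm, rfl⟩
  have htpow : 0 < (t : ℝ) ^ (r - 2) := by positivity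
  have ht2 : 2 ≤ t := by
    by_contra! h
    obtain rfl : t = 1 := by omega
    rw [Nat.choose_eq_zero_of_lt (by omega : 1 < r)] at hm
    have hm0 : (0 : ℝ) ≤ m := Nat.cast_nonneg m
    simp only [Nat.cast_zero, Nat.cast_one, one_pow] at hm
    linarith
  obtain ⟨x, hx, hxH⟩ := (FranklFuredi.isGreatest_lagrangian H).1
  have hst := FranklFuredi.isStationary_of_lagrangePoly_eq hH hx hxH
  rcases Nat.lt_or_ge #x.support t with hn | hn
  · exact hst.lam_le_esym.trans
      (FranklFuredi.esym_le_lagrangian_colexInit (by omega) hmt (by omega) hx.1 hx.2)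
  · by_contra! hlt
    have h1 := FranklFuredi.le_factorial_mul_lagrangian_colexInit (by omega : 1 ≤ r)
      (by omega : 1 ≤ t - 1) hmt
    have h2 : (r.factorial : ℝ) * FranklFuredi.lagrangian (FranklFuredi.colexInit m r) ≤
        r.factorial * FranklFuredi.lagrangian H := by gcongr
    have ht2' : (2 : ℝ) ≤ t := by exact_mod_cast ht2
    have hr' : (4 : ℝ) ≤ r := by exact_mod_cast hr
    -- Passing from `t - 1` to `t` is what produces the `r ^ 2 / t ^ 2` term in
    -- `exists_choose_sub_le_card`.
    have h3 : 1 / ((t : ℝ) - 1) ≤ 1 / t + 2 / t ^ 2 := by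
      rw [div_add_div _ _ (by positivity) (by positivity), div_le_div_iff₀ (by linarith)
        (by positivity)]
      nlinarith
    have h4 : (r : ℝ) * (r - 1) / 2 / (t - 1) ≤ r * (r - 1) / 2 / t + r ^ 2 / t ^ 2 := by
      calc (r : ℝ) * (r - 1) / 2 / (t - 1) = r * (r - 1) / 2 * (1 / (t - 1)) := by ring
        _ ≤ r * (r - 1) / 2 * (1 / t + 2 / t ^ 2) := by
          refine mul_le_mul_of_nonneg_left h3 ?_
          nlinarith
        _ = r * (r - 1) / 2 / t + r * (r - 1) / t ^ 2 := by ring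
        _ ≤ _ := by
          gcongr
          nlinarith
    rw [Nat.cast_sub (by omega), Nat.cast_one] at h1
    have h5 := hC hst ht hn (by linarith)
    have h6 : (#{A ∈ H | A ⊆ x.support} : ℝ) ≤ m := by
      rw [← hHm]
      exact_mod_cast card_filter_le _ _
    linarith
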